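/- Let $n\ge 1$ be an integer and let $0<p<\frac{2n}{n-1}$ (that is, $0<p<\infty$ if $n=1$). There is a constant $c>0$, depending only on $n$ and $p$, such that $$\frac{\big\||x|f\big\|_{L^p(\mathbb R^n)}}{\|f\|_{L^p(\mathbb R^n)}}\cdot\frac{\big\||\xi|\hat f\big\|_{L^p(\mathbb R^n)}}{\|\hat f\|_{L^p(\mathbb R^n)}}\ \ge\ c$$ for every $f:\mathbb R^n\to\mathbb C$ with $f\in L^p(\mathbb R^n)$, $\hat f\in L^p(\mathbb R^n)$ and $f$ not almost everywhere zero, where in the case $p<1$ the function $f$ is in addition assumed to be integrable, so that its Fourier transform is defined. Here $\hat f$ is the Fourier transform with the normalization $\hat f(\xi)=\int_{\mathbb R^n}e^{-ix\cdot\xi}f(x)\,dx$, understood in the sense of tempered distributions: $\hat f$ is the function (locally integrable, and integrable against every Schwartz function) with $\int\hat f\,\varphi=\int f\,\hat\varphi$ for all Schwartz functions $\varphi$. For $0<p<1$, $\|h\|_{L^p}=(\int|h|^p)^{1/p}$. The weighted norms $\||x|f\|_{L^p}$ and $\||\xi|\hat f\|_{L^p}$ may be $+\infty$, in which case the inequality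 holds trivially. -/

import Mathlib

open MeasureTheory
open scoped ENNReal NNReal SchwartzMap

noncomputable section

/-- The Fourier integral `ξ ↦ ∫ exp (-i x·ξ) f x dx` of a function on `ℝⁿ`. -/
def fourierIntegralExp {n : ℕ} (f : EuclideanSpace ℝ (Fin n) → ℂ)
    (ξ : EuclideanSpace ℝ (Fin n)) : ℂ :=
  ∫ x, Complex.exp (-(Complex.I * ((inner ℝ x ξ : ℝ) : ℂ))) * f x

/-- A function on `ℝⁿ` that defines a tempered distribution by integration:
its product with every Schwartz function is integrable. -/
def PairsWithSchwartz {n : ℕ} (f : EuclideanSpace ℝ (Fin n) → ℂ) : Prop :=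
  ∀ φ : 𝓢(EuclideanSpace ℝ (Fin n), ℂ), Integrable (fun x => f x * φ x) volume

/-- `g` is the Fourier transform of `f` in the sense of tempered distributions: both are functions
that define tempered distributions, and `⟨g, φ⟩ = ⟨f, φ̂⟩` for every Schwartz function `φ`. -/
structure IsFourierTransform {n : ℕ} (f g : EuclideanSpace ℝ (Fin n) → ℂ) : Prop where
  pairs_left : PairsWithSchwartz f
  pairs_right : PairsWithSchwartz g
  integral_eq : ∀ φ : 𝓢(EuclideanSpace ℝ (Fin n), ℂ),
    ∫ ξ, g ξ * φ ξ = ∫ x, f x * fourierIntegralExp (fun ξ => φ ξ) x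

end

/-!
Write `A = ‖|x| f‖_p / ‖f‖_p` and let `B` be the same ratio for the Fourier transform `h` of `f`
(dilated by `2π`, so that Mathlib's normalization applies). A lower bound for `A * B` is needed.
A finite first moment does two things: half of `∫ |h| ^ p` lives on a ball of radius comparable to
`B` (`lintegral_le_two_mul_lintegral_closedBall`), and, by Hölder's inequality, `f` lies in `L^q`
for all `q < p` with `1 / q < 1 / p + 1 / n` (`exists_eLpNorm_le_of_moment`).

For `p > 1` the condition `p < 2n / (n - 1)` is what allows a choice of `q` with `1 < q < 2`,
`q < p < q'` and `1 / q < 1 / p + 1 / n` (`exists_auxiliary_exponent`). Then, up to constants,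
`‖f‖_q ≤ A ^ (n (1/q - 1/p)) ‖f‖_p`, the Hausdorff–Young inequality bounds `h` in weak `L^{q'}` by
`‖f‖_q`, and localization to the ball gives `‖h‖_p ≤ B ^ (n (1/p - 1/q')) ‖h‖_{q', weak}`. Since
`p < q'` strictly, the weak form of Hausdorff–Young suffices; it follows from the `L¹ → L^∞` bound
and Plancherel's theorem by cutting `f` at a suitable height (`IsFourierPair.measure_lt_norm_le`),
so no interpolation theory is needed. Exchanging the roles of `f` and `h` by Fourier inversion and
multiplying the two estimates, the norms cancel and `1 ≤ C (A B) ^ (n (1/q - 1/q'))` remains.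

For `p ≤ 1` the function `f` is integrable. Here `‖h‖_∞ ≤ ‖f‖_1`, localization bounds `‖h‖_1` by
`B ^ n ‖h‖_∞`, and the same holds with the roles exchanged, so that
`‖f‖_1 ≤ C (A B) ^ n ‖f‖_1` (`exists_le_mul_of_le_one`).
-/

/-! ### Fourier transforms in the sense of tempered distributions -/

section FourierPairs

open Real FourierTransform

variable {V : Type*} [NormedAddCommGroup V] [InnerProductSpace ℝ V] [FiniteDimensional ℝ V]
  [MeasurableSpace V] [BorelSpace V]

/-- `h` is the Fourier transform of `f` in the sense of tempered distributions, in Mathlib's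
normalization `∫ exp (-2πi⟪x, ξ⟫) f x dx`. -/
structure IsFourierPair (f h : V → ℂ) : Prop where
  integrable_left : ∀ φ : 𝓢(V, ℂ), Integrable (fun x => f x * φ x)
  integrable_right : ∀ φ : 𝓢(V, ℂ), Integrable (fun x => h x * φ x)
  integral_eq : ∀ φ : 𝓢(V, ℂ), ∫ ξ, h ξ * φ ξ = ∫ x, f x * 𝓕 φ x


/-- Test functions are Schwartz functions, so only local integrability of `u` is at stake. It follows
from the hypothesis applied to bump functions, since these equal `1` on a given compact set. -/
theorem ae_eq_zero_of_integral_mul_schwartz {u : V → ℂ}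
    (hu : ∀ φ : 𝓢(V, ℂ), Integrable (fun x => u x * φ x))
    (h0 : ∀ φ : 𝓢(V, ℂ), ∫ x, u x * φ x = 0) : u =ᵐ[volume] 0 := by
  have hloc : LocallyIntegrable u := by
    rw [locallyIntegrable_iff]
    intro K hK
    obtain ⟨r, hr⟩ := hK.isBounded.subset_closedBall (0 : V)
    let b : ContDiffBump (0 : V) := ⟨max r 1, max r 1 + 1, by positivity, by linarith⟩
    have h1 : HasCompactSupport (Complex.ofRealCLM ∘ b) := b.hasCompactSupport.comp_left rfl
    have h2 : ContDiff ℝ (⊤ : ℕ∞) (Complex.ofRealCLM ∘ b) :=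
      Complex.ofRealCLM.contDiff.comp b.contDiff
    refine (hu (h1.toSchwartzMap h2)).integrableOn.congr_fun_ae ?_
    refine (ae_restrict_iff' hK.measurableSet).2 (ae_of_all _ fun x hx => ?_)
    have : b x = 1 := b.one_of_mem_closedBall
      (Metric.closedBall_subset_closedBall (le_max_left _ _) (hr hx))
    simp [this]
  refine ae_eq_zero_of_integral_contDiff_smul_eq_zero hloc fun g hg hgc => ?_
  have h1 : HasCompactSupport (Complex.ofRealCLM ∘ g) := hgc.comp_left rfl
  have h2 : ContDiff ℝ (⊤ : ℕ∞) (Complex.ofRealCLM ∘ g) := Complex.ofRealCLM.contDiff.comp hg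
  rw [← h0 (h1.toSchwartzMap h2)]
  simp [mul_comm]

theorem integrable_mul_schwartz {p : ℝ≥0∞} (hp : 1 ≤ p) {f : V → ℂ} (hf : MemLp f p volume)
    (φ : 𝓢(V, ℂ)) : Integrable (fun x => f x * φ x) := by
  have := ENNReal.HolderConjugate.inv_one_sub_inv' hp
  exact hf.integrable_mul (φ.memLp (1 - p⁻¹)⁻¹ volume)

theorem enorm_fourier_le (f : V → ℂ) (ξ : V) : ‖𝓕 f ξ‖ₑ ≤ eLpNorm f 1 volume := by
  rw [eLpNorm_one_eq_lintegral_enorm]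
  refine (enorm_integral_le_lintegral_enorm _).trans (le_of_eq ?_)
  simp [← ofReal_norm, Circle.norm_smul]

namespace IsFourierPair

variable {f h : V → ℂ}

theorem of_integrable (hf : Integrable f) : IsFourierPair f (𝓕 f) where
  integrable_left := integrable_mul_schwartz le_rfl (memLp_one_iff_integrable.2 hf)
  integrable_right φ := by
    refine φ.integrable.bdd_mul (c := ∫ x, ‖f x‖) ?_ (ae_of_all _ fun ξ => ?_)
    · exact (VectorFourier.fourierIntegral_continuous continuous_fourierChar
        (L := innerₗ V) continuous_inner hf).aestronglyMeasurable
    · exact VectorFourier.norm_fourierIntegral_le_integral_norm _ _ _ _ _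
  integral_eq φ := by
    simpa using! VectorFourier.integral_fourierIntegral_smul_eq_flip (L := innerₗ V)
      continuous_fourierChar continuous_inner hf φ.integrable

/-- Plancherel's theorem for the distributional Fourier transform. -/
theorem exists_of_memLp_two (hf : MemLp f 2 volume) :
    ∃ h, IsFourierPair f h ∧ MemLp h 2 volume ∧ eLpNorm h 2 volume = eLpNorm f 2 volume := by
  let F : Lp ℂ 2 (volume : Measure V) := hf.toLp f
  refine ⟨(𝓕 F : Lp ℂ 2 (volume : Measure V)), ⟨integrable_mul_schwartz one_le_two hf,
    integrable_mul_schwartz one_le_two (Lp.memLp _), fun φ => ?_⟩, Lp.memLp _, ?_⟩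
  · have h1 := congrArg (fun T : 𝓢'(V, ℂ) => T φ) (Lp.fourier_toTemperedDistribution_eq F)
    simp only [TemperedDistribution.fourier_apply, Lp.toTemperedDistribution_apply,
      smul_eq_mul] at h1
    calc _ = ∫ x, φ x * (𝓕 F : Lp ℂ 2 (volume : Measure V)) x := by simp_rw [mul_comm]
      _ = _ := h1.symm
      _ = _ := by
        refine integral_congr_ae ?_
        filter_upwards [hf.coeFn_toLp] with x hx
        rw [mul_comm, hx]
  · have h1 := Lp.norm_fourier_eq F
    rw [Lp.norm_def, Lp.norm_def, ENNReal.toReal_eq_toReal_iff' (Lp.eLpNorm_ne_top _)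
      (Lp.eLpNorm_ne_top _)] at h1
    rw [h1]
    exact eLpNorm_congr_ae hf.coeFn_toLp

theorem add {f' h' : V → ℂ} (H : IsFourierPair f h) (H' : IsFourierPair f' h') :
    IsFourierPair (f + f') (h + h') where
  integrable_left φ := by
    simpa [add_mul] using! (H.integrable_left φ).add (H'.integrable_left φ)
  integrable_right φ := by
    simpa [add_mul] using! (H.integrable_right φ).add (H'.integrable_right φ)
  integral_eq φ := by
    simp only [Pi.add_apply, add_mul]
    rw [integral_add (H.integrable_right φ) (H'.integrable_right φ),
      integral_add (H.integrable_left (𝓕 φ)) (H'.integrable_left (𝓕 φ)),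
      H.integral_eq, H'.integral_eq]

theorem ae_unique {h' : V → ℂ} (H : IsFourierPair f h) (H' : IsFourierPair f h') :
    h =ᵐ[volume] h' := by
  have := ae_eq_zero_of_integral_mul_schwartz (u := h - h')
    (fun φ => by simpa [sub_mul] using! (H.integrable_right φ).sub (H'.integrable_right φ))
    (fun φ => by
      simp only [Pi.sub_apply, sub_mul]
      rw [integral_sub (H.integrable_right φ) (H'.integrable_right φ), H.integral_eq,
        H'.integral_eq, sub_self])
  filter_upwards [this] with x hx
  simpa [sub_eq_zero] using hx

/-- Fourier inversion: `f` is the Fourier transform of the reflection of its own transform. -/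
theorem symm (H : IsFourierPair f h) : IsFourierPair (fun x => h (-x)) f where
  integrable_left φ := by
    have := (H.integrable_right (SchwartzMap.compCLMOfContinuousLinearEquiv ℂ
      (LinearIsometryEquiv.neg ℝ (E := V)).toContinuousLinearEquiv φ)).comp_neg
    simpa using this
  integrable_right := H.integrable_left
  integral_eq φ := by
    have h1 := H.integral_eq (𝓕⁻ φ)
    rw [FourierTransform.fourier_fourierInv_eq] at h1
    rw [← h1, ← integral_neg_eq_self]
    simp [SchwartzMap.fourierInv_apply_eq]

theorem ae_eq_zero (H : IsFourierPair f h) (h0 : h =ᵐ[volume] 0) : f =ᵐ[volume] 0 := by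
  refine ae_eq_zero_of_integral_mul_schwartz H.integrable_left fun φ => ?_
  have h1 := H.integral_eq (𝓕⁻ φ)
  rw [FourierTransform.fourier_fourierInv_eq] at h1
  rw [← h1]
  refine integral_eq_zero_of_ae ?_
  filter_upwards [h0] with x hx
  simp [hx]

theorem enorm_le_of_integrable (H : IsFourierPair f h) (hf : Integrable f) :
    ∀ᵐ ξ, ‖h ξ‖ₑ ≤ eLpNorm f 1 volume := by
  filter_upwards [H.ae_unique (of_integrable hf)] with ξ hξ
  exact hξ ▸ enorm_fourier_le f ξ

/-- If `f` splits into an integrable and a square integrable part, its transform splits into a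
bounded part and a square integrable part, with the corresponding norm bounds. -/
theorem exists_add (H : IsFourierPair f h) {f₁ f₂ : V → ℂ} (hadd : f = f₁ + f₂)
    (h₁ : Integrable f₁) (h₂ : MemLp f₂ 2 volume) :
    ∃ u v : V → ℂ, h =ᵐ[volume] u + v ∧ (∀ ξ, ‖u ξ‖ₑ ≤ eLpNorm f₁ 1 volume) ∧
      MemLp v 2 volume ∧ eLpNorm v 2 volume = eLpNorm f₂ 2 volume := by
  obtain ⟨v, Hv, hv, hv'⟩ := exists_of_memLp_two h₂
  subst hadd
  exact ⟨𝓕 f₁, v, H.ae_unique ((of_integrable h₁).add Hv), enorm_fourier_le f₁, hv, hv'⟩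

end IsFourierPair

end FourierPairs

/-! ### First moments, dilations and the layer cake formula -/

section LpEstimates

theorem eLpNorm_ofReal_rpow {α E : Type*} [MeasurableSpace α] [NormedAddCommGroup E]
    {μ : Measure α} {p : ℝ} (hp : 0 < p) (f : α → E) :
    eLpNorm f (ENNReal.ofReal p) μ ^ p = ∫⁻ x, ‖f x‖ₑ ^ p ∂μ := by
  rw [eLpNorm_eq_lintegral_rpow_enorm_toReal (by simpa using hp) ENNReal.ofReal_ne_top,
    ENNReal.toReal_ofReal hp.le, ← ENNReal.rpow_mul, one_div_mul_cancel hp.ne', ENNReal.rpow_one]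

/-- A function on a set of measure at most `v` whose distribution function is at most `(M / t) ^ s`
has `L^p` norm controlled by `M` for `p < s`. The layer cake integral is cut at the height
`M * v ^ (-1 / s)`, where the two bounds for the distribution function agree. -/
theorem lintegral_rpow_le_of_meas_lt_le {α E : Type*} [MeasurableSpace α] [NormedAddCommGroup E]
    {μ : Measure α} {p s v M : ℝ} (hp : 0 < p) (hps : p < s) (hv : 0 < v) (hM : 0 < M)
    (hμ : μ Set.univ ≤ ENNReal.ofReal v) {u : α → E} (hu : AEStronglyMeasurable u μ)
    (hmeas : ∀ t : ℝ, 0 < t → μ {x | t < ‖u x‖} ≤ ENNReal.ofReal ((M / t) ^ s)) :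
    ∫⁻ x, ‖u x‖ₑ ^ p ∂μ ≤ ENNReal.ofReal (s / (s - p) * M ^ p * v ^ (1 - p / s)) := by
  have hs : 0 < s := hp.trans hps
  set T : ℝ := M * v ^ (-1 / s) with hT
  have hT0 : 0 < T := by positivity
  have h1 : ∫⁻ x, ‖u x‖ₑ ^ p ∂μ =
      ENNReal.ofReal p * ∫⁻ t in Set.Ioi 0, μ {x | t < ‖u x‖} * ENNReal.ofReal (t ^ (p - 1)) := by
    rw [← lintegral_rpow_eq_lintegral_meas_lt_mul μ (ae_of_all _ fun x => norm_nonneg (u x))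
      hu.norm.aemeasurable hp]
    refine lintegral_congr fun x => ?_
    rw [← ENNReal.ofReal_rpow_of_nonneg (norm_nonneg _) hp.le, ofReal_norm]
  have hlow : ∫⁻ t in Set.Ioc 0 T, μ {x | t < ‖u x‖} * ENNReal.ofReal (t ^ (p - 1)) ≤
      ENNReal.ofReal (v * (T ^ p / p)) := by
    have hint : IntegrableOn (fun t : ℝ => v * t ^ (p - 1)) (Set.Ioc 0 T) := by
      refine Integrable.const_mul ?_ v
      exact (intervalIntegrable_iff_integrableOn_Ioc_of_le hT0.le).1
        (intervalIntegral.intervalIntegrable_rpow' (by linarith))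
    have hval : ∫ t in Set.Ioc 0 T, v * t ^ (p - 1) = v * (T ^ p / p) := by
      rw [integral_const_mul, ← intervalIntegral.integral_of_le hT0.le,
        integral_rpow (Or.inl (by linarith))]
      simp [Real.zero_rpow hp.ne']
    rw [← hval, ofReal_integral_eq_lintegral_ofReal hint]
    · refine setLIntegral_mono_ae' measurableSet_Ioc (ae_of_all _ fun t ht => ?_)
      rw [ENNReal.ofReal_mul hv.le]
      gcongr
      exact (measure_mono (Set.subset_univ _)).trans hμ
    · refine (ae_restrict_iff' measurableSet_Ioc).2 (ae_of_all _ fun t ht => ?_)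
      have := ht.1
      simp only [Pi.zero_apply]
      positivity
  have hhigh : ∫⁻ t in Set.Ioi T, μ {x | t < ‖u x‖} * ENNReal.ofReal (t ^ (p - 1)) ≤
      ENNReal.ofReal (M ^ s * (T ^ (p - s) / (s - p))) := by
    have hint : IntegrableOn (fun t : ℝ => M ^ s * t ^ (p - 1 - s)) (Set.Ioi T) :=
      (integrableOn_Ioi_rpow_of_lt (by linarith) hT0).const_mul _
    have hval : ∫ t in Set.Ioi T, M ^ s * t ^ (p - 1 - s) = M ^ s * (T ^ (p - s) / (s - p)) := by
      rw [integral_const_mul, integral_Ioi_rpow_of_lt (by linarith) hT0,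
        show p - 1 - s + 1 = p - s by ring, show s - p = -(p - s) by ring, div_neg, neg_div]
    rw [← hval, ofReal_integral_eq_lintegral_ofReal hint]
    · refine setLIntegral_mono_ae' measurableSet_Ioi (ae_of_all _ fun t ht => ?_)
      have ht0 : 0 < t := hT0.trans ht
      have : M ^ s * t ^ (p - 1 - s) = (M / t) ^ s * t ^ (p - 1) := by
        rw [Real.div_rpow hM.le ht0.le, Real.rpow_sub ht0]
        ring
      rw [this, ENNReal.ofReal_mul (by positivity)]
      gcongr
      exact hmeas t ht0
    · refine (ae_restrict_iff' measurableSet_Ioi).2 (ae_of_all _ fun t ht => ?_)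
      have ht0 : 0 < t := hT0.trans ht
      simp only [Pi.zero_apply]
      positivity
  have hTp : v * T ^ p = M ^ p * v ^ (1 - p / s) := by
    rw [hT, Real.mul_rpow hM.le (by positivity), ← Real.rpow_mul hv.le, sub_eq_add_neg,
      Real.rpow_add hv, Real.rpow_one, show -1 / s * p = -(p / s) by ring]
    ring
  have hTs : M ^ s * T ^ (p - s) = M ^ p * v ^ (1 - p / s) := by
    rw [hT, Real.mul_rpow hM.le (by positivity), ← Real.rpow_mul hv.le, ← mul_assoc,
      ← Real.rpow_add hM, show -1 / s * (p - s) = 1 - p / s by field_simp; ring]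
    congr 2
    ring
  rw [h1, ← Set.Ioc_union_Ioi_eq_Ioi hT0.le]
  calc _ ≤ ENNReal.ofReal p * (ENNReal.ofReal (v * (T ^ p / p)) +
        ENNReal.ofReal (M ^ s * (T ^ (p - s) / (s - p)))) := by
        gcongr
        exact (lintegral_union_le _ _ _).trans (add_le_add hlow hhigh)
    _ = ENNReal.ofReal (p * (v * (T ^ p / p) + M ^ s * (T ^ (p - s) / (s - p)))) := by
        have : 0 < s - p := by linarith
        rw [← ENNReal.ofReal_add (by positivity) (by positivity), ← ENNReal.ofReal_mul hp.le]
    _ = _ := by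
        congr 1
        have : s - p ≠ 0 := by linarith
        rw [← mul_div_assoc, ← mul_div_assoc, hTp, hTs]
        field_simp
        ring

variable {V : Type*} [NormedAddCommGroup V] [InnerProductSpace ℝ V] [FiniteDimensional ℝ V]
  [MeasurableSpace V] [BorelSpace V]

open Module (finrank)

theorem eLpNorm_comp_const_smul {E : Type*} [NormedAddCommGroup E] {p : ℝ} (hp : 0 < p) {r : ℝ}
    (hr : 0 < r) (u : V → E) :
    eLpNorm (fun x => u (r • x)) (ENNReal.ofReal p) volume =
      ENNReal.ofReal (r ^ (-(finrank ℝ V / p))) * eLpNorm u (ENNReal.ofReal p) volume := by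
  have h1 := (Homeomorph.smulOfNeZero r hr.ne').measurableEmbedding.eLpNorm_map_measure
    (g := u) (p := ENNReal.ofReal p) (μ := (volume : Measure V))
  have h2 : (u ∘ (Homeomorph.smulOfNeZero r hr.ne' : V → V)) = fun x => u (r • x) := rfl
  rw [← h2, ← h1]
  change eLpNorm u _ (Measure.map (r • ·) volume) = _
  rw [Measure.map_addHaar_smul _ hr.ne', eLpNorm_smul_measure_of_ne_top ENNReal.ofReal_ne_top,
    smul_eq_mul, abs_of_pos (by positivity), ENNReal.ofReal_rpow_of_pos (by positivity)]
  congr 2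
  rw [one_div, ENNReal.toReal_inv, ENNReal.toReal_ofReal hp.le, ← Real.rpow_natCast,
    ← Real.rpow_neg hr.le, ← Real.rpow_mul hr.le]
  congr 1
  ring

theorem memLp_comp_const_smul {E : Type*} [NormedAddCommGroup E] {p : ℝ≥0∞} {r : ℝ} (hr : r ≠ 0)
    {u : V → E} (hu : MemLp u p volume) : MemLp (fun x => u (r • x)) p volume := by
  refine ((Homeomorph.smulOfNeZero r hr).measurableEmbedding.memLp_map_measure_iff
    (g := u) (p := p) (μ := (volume : Measure V))).1 ?_
  change MemLp u p (Measure.map (r • ·) volume)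
  rw [Measure.map_addHaar_smul _ hr]
  exact hu.smul_measure ENNReal.ofReal_ne_top

/-- Chebyshev's inequality for the first `L^p` moment: at least half of `∫ ‖u‖ ^ p` is carried by a
ball of radius comparable to `B`. -/
theorem lintegral_le_two_mul_lintegral_closedBall {p B : ℝ} (hp : 0 < p) (hB : 0 < B) {u : V → ℂ}
    (hu : MemLp u (ENNReal.ofReal p) volume)
    (hle : eLpNorm (fun x => (‖x‖ : ℂ) * u x) (ENNReal.ofReal p) volume ≤
      ENNReal.ofReal B * eLpNorm u (ENNReal.ofReal p) volume) :
    ∫⁻ x, ‖u x‖ₑ ^ p ≤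
      2 * ∫⁻ x in Metric.closedBall (0 : V) (2 ^ (1 / p) * B), ‖u x‖ₑ ^ p := by
  set R := 2 ^ (1 / p) * B with hR
  have hR0 : 0 < R := by positivity
  have hRp : R ^ p = 2 * B ^ p := by
    rw [hR, Real.mul_rpow (by positivity) hB.le, ← Real.rpow_mul (by norm_num),
      one_div_mul_cancel hp.ne', Real.rpow_one]
  set E := Metric.closedBall (0 : V) R
  have hE : MeasurableSet E := Metric.isClosed_closedBall.measurableSet
  have hfin : ∫⁻ x, ‖u x‖ₑ ^ p ≠ ⊤ := by
    rw [← eLpNorm_ofReal_rpow hp]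
    exact ENNReal.rpow_ne_top_of_nonneg hp.le hu.eLpNorm_ne_top
  have hsplit := lintegral_add_compl (μ := volume) (fun x => ‖u x‖ₑ ^ p) hE
  have hpow : ∫⁻ x, ENNReal.ofReal (‖x‖ ^ p) * ‖u x‖ₑ ^ p ≤
      ENNReal.ofReal (B ^ p) * ∫⁻ x, ‖u x‖ₑ ^ p := by
    have := ENNReal.rpow_le_rpow hle hp.le
    rw [ENNReal.mul_rpow_of_nonneg _ _ hp.le, eLpNorm_ofReal_rpow hp, eLpNorm_ofReal_rpow hp,
      ENNReal.ofReal_rpow_of_pos hB] at this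
    refine le_trans (le_of_eq (lintegral_congr fun x => ?_)) this
    rw [enorm_mul, ENNReal.mul_rpow_of_nonneg _ _ hp.le,
      ← ENNReal.ofReal_rpow_of_nonneg (norm_nonneg _) hp.le]
    congr 2
    rw [← ofReal_norm, Complex.norm_real, norm_norm]
  have htail : ENNReal.ofReal (B ^ p) * (2 * ∫⁻ x in Eᶜ, ‖u x‖ₑ ^ p) ≤
      ENNReal.ofReal (B ^ p) * ∫⁻ x, ‖u x‖ₑ ^ p := by
    refine le_trans ?_ hpow
    refine le_trans ?_ (setLIntegral_le_lintegral Eᶜ _)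
    rw [← mul_assoc, ← lintegral_const_mul']
    · refine setLIntegral_mono_ae' hE.compl (ae_of_all _ fun x hx => ?_)
      gcongr
      have hx' : R ≤ ‖x‖ := by
        have := mt mem_closedBall_zero_iff.2 hx
        linarith
      rw [show (2 : ℝ≥0∞) = ENNReal.ofReal 2 by simp, ← ENNReal.ofReal_mul (by positivity),
        mul_comm, ← hRp]
      gcongr
    · exact ENNReal.mul_ne_top ENNReal.ofReal_ne_top (by norm_num)
  have htail' := (ENNReal.mul_le_mul_iff_right (by simpa using Real.rpow_pos_of_pos hB p)
    ENNReal.ofReal_ne_top).1 htail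
  have hfin' : ∫⁻ x in Eᶜ, ‖u x‖ₑ ^ p ≠ ⊤ :=
    ne_top_of_le_ne_top hfin (setLIntegral_le_lintegral _ _)
  rw [← hsplit, two_mul] at htail'
  have hcmp := (ENNReal.add_le_add_iff_right hfin').1 htail'
  rw [← hsplit, two_mul]
  gcongr

/-- Hölder's inequality with weight `(1 + ‖x‖ / A)⁻¹`, which lies in `L^r` for `r` larger than the
dimension: control of the first moment in `L^p` improves integrability at infinity. -/
theorem exists_eLpNorm_le_of_moment {p q : ℝ} (hq : 0 < q) (hqp : q < p) (hp : 1 ≤ p)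
    (hn : finrank ℝ V * (1 / q - 1 / p) < 1) :
    ∃ C : ℝ, 0 < C ∧ ∀ (f : V → ℂ) (A : ℝ), 0 < A → AEStronglyMeasurable f volume →
      eLpNorm (fun x => (‖x‖ : ℂ) * f x) (ENNReal.ofReal p) volume ≤
        ENNReal.ofReal A * eLpNorm f (ENNReal.ofReal p) volume →
      eLpNorm f (ENNReal.ofReal q) volume ≤
        ENNReal.ofReal (C * A ^ (finrank ℝ V * (1 / q - 1 / p))) *
          eLpNorm f (ENNReal.ofReal p) volume := by
  have hp0 : 0 < p := by linarith
  set e := 1 / q - 1 / p with he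
  have he0 : 0 < e := sub_pos.2 (one_div_lt_one_div_of_lt hq hqp)
  -- The exponent of the weight, determined by Hölder's relation `1 / q = 1 / r + 1 / p`.
  set r := 1 / e with hr
  have hr0 : 0 < r := by positivity
  have hre : 1 / r = e := by rw [hr, one_div_one_div]
  have hnr : (finrank ℝ V : ℝ) < r := by rw [hr, lt_div_iff₀ he0]; exact hn
  let w : V → ℝ := fun x => (1 + ‖x‖)⁻¹
  have hwc : Continuous w := by
    refine Continuous.inv₀ (by fun_prop) fun x => ?_
    positivity
  have hw : MemLp w (ENNReal.ofReal r) volume := by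
    refine ⟨hwc.aestronglyMeasurable, ?_⟩
    rw [eLpNorm_lt_top_iff_lintegral_rpow_enorm_lt_top (by simpa using hr0) ENNReal.ofReal_ne_top,
      ENNReal.toReal_ofReal hr0.le]
    refine lt_of_eq_of_lt (lintegral_congr fun x => ?_)
      (finite_integral_one_add_norm (μ := (volume : Measure V)) hnr)
    have : 0 < 1 + ‖x‖ := by positivity
    rw [← ofReal_norm, Real.norm_of_nonneg (by positivity),
      ENNReal.ofReal_rpow_of_nonneg (by positivity) hr0.le, Real.inv_rpow this.le,
      Real.rpow_neg this.le]
  set K := (eLpNorm w (ENNReal.ofReal r) volume).toReal with hK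
  have hKle : eLpNorm w (ENNReal.ofReal r) volume ≤ ENNReal.ofReal (K + 1) := by
    rw [← ENNReal.ofReal_toReal hw.eLpNorm_ne_top]
    exact ENNReal.ofReal_le_ofReal (by linarith)
  have hK0 : 0 ≤ K := ENNReal.toReal_nonneg
  refine ⟨(K + 1) * 2, by positivity, fun f A hA hf hle => ?_⟩
  let g : V → ℂ := f + (A⁻¹ : ℂ) • fun x => (‖x‖ : ℂ) * f x
  have hxf : AEStronglyMeasurable (fun x : V => (‖x‖ : ℂ) * f x) volume :=
    (by fun_prop : Continuous fun x : V => (‖x‖ : ℂ)).aestronglyMeasurable.mul hf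
  have hg : AEStronglyMeasurable g volume := hf.add (hxf.const_smul _)
  have hfg : f = (fun x => w (A⁻¹ • x)) • g := by
    ext x
    have h1 : (0 : ℝ) < 1 + A⁻¹ * ‖x‖ := by positivity
    have h2 : (1 + (A : ℂ)⁻¹ * ‖x‖) ≠ 0 := by exact_mod_cast h1.ne'
    simp only [w, g, Pi.smul_apply', Pi.add_apply, Pi.smul_apply, norm_smul, norm_inv,
      Real.norm_of_nonneg hA.le, Complex.real_smul, smul_eq_mul]
    push_cast
    rw [show f x + (A : ℂ)⁻¹ * (‖x‖ * f x) = (1 + (A : ℂ)⁻¹ * ‖x‖) * f x by ring,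
      inv_mul_cancel_left₀ h2]
  have htriple : ENNReal.HolderTriple (ENNReal.ofReal r) (ENNReal.ofReal p) (ENNReal.ofReal q) := by
    constructor
    rw [← ENNReal.ofReal_inv_of_pos hr0, ← ENNReal.ofReal_inv_of_pos hp0,
      ← ENNReal.ofReal_inv_of_pos hq, ← ENNReal.ofReal_add (by positivity) (by positivity)]
    congr 1
    rw [← one_div, hre, he]
    ring
  have hgle : eLpNorm g (ENNReal.ofReal p) volume ≤
      2 * eLpNorm f (ENNReal.ofReal p) volume := by
    refine (eLpNorm_add_le hf (hxf.const_smul _) (by simpa using hp)).trans ?_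
    rw [two_mul]
    gcongr
    rw [eLpNorm_const_smul]
    calc _ ≤ ‖(A⁻¹ : ℂ)‖ₑ * (ENNReal.ofReal A * eLpNorm f (ENNReal.ofReal p) volume) := by gcongr
      _ = _ := by
        rw [← mul_assoc, ← ofReal_norm, ← ENNReal.ofReal_mul (by positivity), norm_inv,
          Complex.norm_real, Real.norm_of_nonneg hA.le, inv_mul_cancel₀ hA.ne']
        simp
  have hwA : AEStronglyMeasurable (fun x => w (A⁻¹ • x)) volume :=
    (hwc.comp (continuous_const_smul _)).aestronglyMeasurable
  calc eLpNorm f (ENNReal.ofReal q) volume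
      = eLpNorm ((fun x => w (A⁻¹ • x)) • g) (ENNReal.ofReal q) volume := by rw [← hfg]
    _ ≤ eLpNorm (fun x => w (A⁻¹ • x)) (ENNReal.ofReal r) volume *
        eLpNorm g (ENNReal.ofReal p) volume := eLpNorm_smul_le_mul_eLpNorm hg hwA
    _ ≤ (ENNReal.ofReal (A⁻¹ ^ (-(finrank ℝ V / r))) * ENNReal.ofReal (K + 1)) *
        (2 * eLpNorm f (ENNReal.ofReal p) volume) := by
        rw [eLpNorm_comp_const_smul hr0 (by positivity)]
        gcongr
    _ = _ := by
        rw [show (2 : ℝ≥0∞) = ENNReal.ofReal 2 by simp, ← mul_assoc,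
          ← ENNReal.ofReal_mul (by positivity), ← ENNReal.ofReal_mul (by positivity)]
        congr 2
        rw [Real.inv_rpow hA.le, Real.rpow_neg hA.le, inv_inv, div_eq_mul_one_div _ r, hre]
        ring

end LpEstimates

/-! ### The uncertainty inequality in Mathlib normalization -/

section Uncertainty

open Real FourierTransform
open Module (finrank)

variable {V : Type*} [NormedAddCommGroup V] [InnerProductSpace ℝ V] [FiniteDimensional ℝ V]
  [MeasurableSpace V] [BorelSpace V]

namespace IsFourierPair

/-- Weak form of the Hausdorff–Young inequality. For given `t`, cut `f` at the height `l` for which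
the transform of the large part is bounded by `t / 2`; Plancherel's theorem and Chebyshev's
inequality handle the small part. -/
theorem measure_lt_norm_le {f h : V → ℂ} (H : IsFourierPair f h) {q : ℝ} (hq1 : 1 < q) (hq2 : q < 2)
    (hf : AEStronglyMeasurable f volume) {N : ℝ} (hN : 0 < N)
    (hfN : eLpNorm f (ENNReal.ofReal q) volume ≤ ENNReal.ofReal N) {t : ℝ} (ht : 0 < t) :
    volume {x | t < ‖h x‖} ≤ ENNReal.ofReal ((2 * N / t) ^ (q / (q - 1))) := by
  have hq0 : 0 < q := by linarith
  have hq1' : 0 < q - 1 := by linarith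
  have hfI : ∫⁻ x, ‖f x‖ₑ ^ q ≤ ENNReal.ofReal (N ^ q) := by
    rw [← eLpNorm_ofReal_rpow hq0, ← ENNReal.ofReal_rpow_of_pos hN]
    exact ENNReal.rpow_le_rpow hfN hq0.le
  set l : ℝ := t / 2 * (2 * N / t) ^ (q / (q - 1)) with hl
  have hl0 : 0 < l := by positivity
  -- The height `l` is determined by this identity.
  have hlq : l ^ (1 - q) * N ^ q = t / 2 := by
    have h1 : l ^ (q - 1) = N ^ q * (2 / t) := by
      rw [hl, Real.mul_rpow (by positivity) (by positivity), ← Real.rpow_mul (by positivity),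
        div_mul_cancel₀ _ hq1'.ne', show 2 * N / t = N * (t / 2)⁻¹ by field_simp,
        Real.mul_rpow hN.le (by positivity), Real.inv_rpow (by positivity),
        Real.rpow_sub (by positivity), Real.rpow_one]
      field_simp
    rw [show 1 - q = -(q - 1) by ring, Real.rpow_neg hl0.le, h1]
    field_simp
  have hlq2 : l ^ (2 - q) * N ^ q = l * (t / 2) := by
    rw [← hlq, ← mul_assoc, show 2 - q = 1 + (1 - q) by ring, Real.rpow_add hl0, Real.rpow_one]
  let f₁ : V → ℂ := fun x => if l < ‖f x‖ then f x else 0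
  let f₂ : V → ℂ := fun x => if l < ‖f x‖ then 0 else f x
  have hS : MeasurableSet {z : ℂ | l < ‖z‖} := measurableSet_lt measurable_const measurable_norm
  have hf₁ : AEStronglyMeasurable f₁ volume :=
    ((Measurable.ite hS measurable_id measurable_const).comp_aemeasurable
      hf.aemeasurable).aestronglyMeasurable
  have hf₂ : AEStronglyMeasurable f₂ volume :=
    ((Measurable.ite hS measurable_const measurable_id).comp_aemeasurable
      hf.aemeasurable).aestronglyMeasurable
  have hadd : f = f₁ + f₂ := by
    ext x
    by_cases hx : l < ‖f x‖ <;> simp [f₁, f₂, hx]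
  have h₁ : eLpNorm f₁ 1 volume ≤ ENNReal.ofReal (t / 2) := by
    rw [eLpNorm_one_eq_lintegral_enorm, ← hlq, ENNReal.ofReal_mul (by positivity)]
    refine le_trans ?_ (mul_le_mul_right hfI _)
    rw [← lintegral_const_mul' _ _ ENNReal.ofReal_ne_top]
    refine lintegral_mono fun x => ?_
    by_cases hx : l < ‖f x‖
    · have h0 : 0 < ‖f x‖ := hl0.trans hx
      simp only [f₁, hx, if_true]
      rw [← ofReal_norm, ENNReal.ofReal_rpow_of_pos h0, ← ENNReal.ofReal_mul (by positivity)]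
      refine ENNReal.ofReal_le_ofReal ?_
      calc ‖f x‖ = ‖f x‖ ^ (1 - q) * ‖f x‖ ^ q := by
            rw [← Real.rpow_add h0, sub_add_cancel, Real.rpow_one]
        _ ≤ _ := by
            gcongr ?_ * _
            exact Real.rpow_le_rpow_of_nonpos hl0 hx.le (by linarith)
    · simp [f₁, hx]
  have h₂ : ∫⁻ x, ‖f₂ x‖ₑ ^ (2 : ℝ) ≤ ENNReal.ofReal (l * (t / 2)) := by
    rw [← hlq2, ENNReal.ofReal_mul (by positivity)]
    refine le_trans ?_ (mul_le_mul_right hfI _)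
    rw [← lintegral_const_mul' _ _ ENNReal.ofReal_ne_top]
    refine lintegral_mono fun x => ?_
    by_cases hx : l < ‖f x‖
    · simp [f₂, hx]
    · simp only [f₂, hx, if_false]
      rw [← ofReal_norm, ENNReal.ofReal_rpow_of_nonneg (norm_nonneg _) (by norm_num),
        ENNReal.ofReal_rpow_of_nonneg (norm_nonneg _) hq0.le, ← ENNReal.ofReal_mul (by positivity)]
      refine ENNReal.ofReal_le_ofReal ?_
      calc ‖f x‖ ^ (2 : ℝ) = ‖f x‖ ^ (2 - q) * ‖f x‖ ^ q := by
            rw [← Real.rpow_add_of_nonneg (norm_nonneg _) (by linarith) hq0.le, sub_add_cancel]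
        _ ≤ _ := by
            gcongr ?_ * _
            exact Real.rpow_le_rpow (norm_nonneg _) (not_lt.1 hx) (by linarith)
  have h₂' : eLpNorm f₂ 2 volume ^ (2 : ℝ) ≤ ENNReal.ofReal (l * (t / 2)) := by
    have := eLpNorm_ofReal_rpow (μ := volume) two_pos f₂
    rw [ENNReal.ofReal_ofNat] at this
    rwa [this]
  have hI₁ : Integrable f₁ :=
    memLp_one_iff_integrable.1 ⟨hf₁, h₁.trans_lt ENNReal.ofReal_lt_top⟩
  have hM₂ : MemLp f₂ 2 volume := by
    refine ⟨hf₂, lt_top_iff_ne_top.2 fun htop => ?_⟩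
    rw [htop, ENNReal.top_rpow_of_pos two_pos] at h₂'
    exact ENNReal.ofReal_ne_top (top_le_iff.1 h₂')
  obtain ⟨u, v, huv, hu, hv, hv₂⟩ := H.exists_add hadd hI₁ hM₂
  have hle : volume {x | t < ‖h x‖} ≤ volume {x | ENNReal.ofReal (t / 2) ≤ ‖v x‖ₑ} := by
    refine measure_mono_ae ?_
    filter_upwards [huv] with x hx (hxt : t < ‖h x‖)
    have hux : ‖u x‖ ≤ t / 2 := by
      have := (hu x).trans h₁
      rwa [← ofReal_norm, ENNReal.ofReal_le_ofReal_iff (by positivity)] at this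
    have htri : ‖h x‖ ≤ ‖u x‖ + ‖v x‖ := by
      rw [hx]
      exact norm_add_le _ _
    change ENNReal.ofReal (t / 2) ≤ ‖v x‖ₑ
    rw [← ofReal_norm]
    exact ENNReal.ofReal_le_ofReal (by linarith)
  have hcheb := mul_meas_ge_le_pow_eLpNorm' volume two_ne_zero ENNReal.ofNat_ne_top hv.1
    (ENNReal.ofReal (t / 2))
  rw [hv₂, ENNReal.toReal_ofNat] at hcheb
  have hkey : ENNReal.ofReal ((t / 2) ^ (2 : ℝ)) * volume {x | t < ‖h x‖} ≤
      ENNReal.ofReal ((t / 2) ^ (2 : ℝ)) * ENNReal.ofReal ((2 * N / t) ^ (q / (q - 1))) := by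
    rw [← ENNReal.ofReal_mul (by positivity)]
    refine le_trans ?_ ((hcheb.trans h₂').trans (le_of_eq ?_))
    · rw [ENNReal.ofReal_rpow_of_pos (by positivity)]
      gcongr
    · rw [hl, Real.rpow_two]
      congr 1
      ring
  have hne : ENNReal.ofReal ((t / 2) ^ (2 : ℝ)) ≠ 0 := by
    simp only [ne_eq, ENNReal.ofReal_eq_zero, not_le]
    positivity
  exact (ENNReal.mul_le_mul_iff_right hne ENNReal.ofReal_ne_top).1 hkey

end IsFourierPair

theorem eLpNorm_comp_neg (p : ℝ≥0∞) {u : V → ℂ} (hu : AEStronglyMeasurable u volume) :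
    eLpNorm (fun x => u (-x)) p volume = eLpNorm u p volume :=
  eLpNorm_comp_measurePreserving hu (Measure.measurePreserving_neg volume)

theorem eLpNorm_norm_mul_comp_neg (p : ℝ≥0∞) {u : V → ℂ} (hu : AEStronglyMeasurable u volume) :
    eLpNorm (fun x => (‖x‖ : ℂ) * u (-x)) p volume =
      eLpNorm (fun x => (‖x‖ : ℂ) * u x) p volume := by
  have hxu : AEStronglyMeasurable (fun x : V => (‖x‖ : ℂ) * u x) volume :=
    (by fun_prop : Continuous fun x : V => (‖x‖ : ℂ)).aestronglyMeasurable.mul hu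
  rw [← eLpNorm_comp_neg p hxu]
  simp

theorem volume_closedBall_eq (r : ℝ) (hr : 0 < r) :
    volume (Metric.closedBall (0 : V) r) =
      ENNReal.ofReal (r ^ finrank ℝ V * (volume (Metric.ball (0 : V) 1)).toReal) := by
  rw [Measure.addHaar_closedBall _ _ hr.le, ENNReal.ofReal_mul (by positivity),
    ENNReal.ofReal_toReal measure_ball_lt_top.ne]

theorem toReal_volume_ball_pos : 0 < (volume (Metric.ball (0 : V) 1)).toReal :=
  ENNReal.toReal_pos (Metric.measure_ball_pos _ _ one_pos).ne' measure_ball_lt_top.ne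

/-- Bound for `‖h‖_p` in terms of `‖f‖_p`: Hölder's inequality passes from `‖f‖_p` to `‖f‖_q`, the
weak Hausdorff–Young inequality to the weak `L^{q'}` norm of `h`, and localization of `h` to a ball
back to `‖h‖_p`. -/
theorem exists_eLpNorm_fourier_le {p q : ℝ} (hq1 : 1 < q) (hq2 : q < 2) (hqp : q < p)
    (hpq : p < q / (q - 1)) (hn : finrank ℝ V * (1 / q - 1 / p) < 1) :
    ∃ C : ℝ, 0 < C ∧ ∀ f h : V → ℂ, IsFourierPair f h → ∀ A B F : ℝ, 0 < A → 0 < B → 0 < F →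
      MemLp f (ENNReal.ofReal p) volume → MemLp h (ENNReal.ofReal p) volume →
      eLpNorm f (ENNReal.ofReal p) volume ≤ ENNReal.ofReal F →
      eLpNorm (fun x => (‖x‖ : ℂ) * f x) (ENNReal.ofReal p) volume ≤
        ENNReal.ofReal A * eLpNorm f (ENNReal.ofReal p) volume →
      eLpNorm (fun x => (‖x‖ : ℂ) * h x) (ENNReal.ofReal p) volume ≤
        ENNReal.ofReal B * eLpNorm h (ENNReal.ofReal p) volume →
      eLpNorm h (ENNReal.ofReal p) volume ≤
        ENNReal.ofReal (C * A ^ (finrank ℝ V * (1 / q - 1 / p)) *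
          B ^ (finrank ℝ V * (1 / p - (1 - 1 / q))) * F) := by
  have hp1 : 1 < p := hq1.trans hqp
  have hp0 : 0 < p := by linarith
  have hq0 : 0 < q := by linarith
  obtain ⟨C₀, hC₀, hHolder⟩ := exists_eLpNorm_le_of_moment (V := V) hq0 hqp hp1.le hn
  set s := q / (q - 1) with hs
  have hs1 : 1 / s = 1 - 1 / q := by
    rw [hs]
    field_simp
  have hsp : 0 < s - p := by linarith
  have hs0 : 0 < s := by linarith
  set w := (volume (Metric.ball (0 : V) 1)).toReal with hw
  have hw0 : 0 < w := toReal_volume_ball_pos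
  set n := finrank ℝ V with hndef
  set K : ℝ := 2 * (s / (s - p)) * 2 ^ p * ((2 ^ (1 / p)) ^ n * w) ^ (1 - p / s) with hK
  have hK0 : 0 < K := by positivity
  refine ⟨K ^ (1 / p) * C₀, by positivity, fun f h H A B F hA hB hF hf hh hfF hfA hhB => ?_⟩
  set N := C₀ * A ^ (n * (1 / q - 1 / p)) * F with hN
  have hN0 : 0 < N := by positivity
  have hfN : eLpNorm f (ENNReal.ofReal q) volume ≤ ENNReal.ofReal N := by
    refine (hHolder f A hA hf.1 hfA).trans ?_
    calc _ ≤ ENNReal.ofReal (C₀ * A ^ (n * (1 / q - 1 / p))) * ENNReal.ofReal F := by gcongr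
      _ = _ := (ENNReal.ofReal_mul (by positivity)).symm
  have hloc := lintegral_le_two_mul_lintegral_closedBall hp0 hB hh hhB
  have hvol := volume_closedBall_eq (V := V) (2 ^ (1 / p) * B) (by positivity)
  have hcake := lintegral_rpow_le_of_meas_lt_le (u := h) (M := 2 * N)
    (μ := volume.restrict (Metric.closedBall (0 : V) (2 ^ (1 / p) * B))) hp0 hpq
    (v := (2 ^ (1 / p) * B) ^ n * w) (by positivity) (by positivity)
    (by rw [Measure.restrict_apply_univ, hvol]) hh.1.restrict
    (fun t ht => (Measure.restrict_apply_le _ _).trans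
      (H.measure_lt_norm_le hq1 hq2 hf.1 hN0 hfN ht))
  refine (ENNReal.rpow_le_rpow_iff hp0).1 ?_
  rw [eLpNorm_ofReal_rpow hp0, ENNReal.ofReal_rpow_of_pos (by positivity)]
  refine (hloc.trans (mul_le_mul_right hcake 2)).trans (le_of_eq ?_)
  rw [show (2 : ℝ≥0∞) = ENNReal.ofReal 2 by simp, ← ENNReal.ofReal_mul (by norm_num)]
  congr 1
  have h1 : K ^ (1 / p) * C₀ * A ^ (n * (1 / q - 1 / p)) * B ^ (n * (1 / p - (1 - 1 / q))) * F =
      K ^ (1 / p) * B ^ (n * (1 / p - (1 - 1 / q))) * N := by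
    rw [hN]
    ring
  have hL : ((2 ^ (1 / p) * B) ^ n * w) ^ (1 - p / s) =
      ((2 ^ (1 / p)) ^ n * w) ^ (1 - p / s) * (B ^ (n * (1 / p - (1 - 1 / q)))) ^ p := by
    rw [mul_pow, mul_right_comm, Real.mul_rpow (by positivity) (by positivity),
      ← Real.rpow_natCast B, ← Real.rpow_mul hB.le, ← Real.rpow_mul hB.le, ← hs1]
    congr 2
    field_simp
  have hR : (K ^ (1 / p) * B ^ (n * (1 / p - (1 - 1 / q))) * N) ^ p =
      K * (B ^ (n * (1 / p - (1 - 1 / q)))) ^ p * N ^ p := by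
    rw [Real.mul_rpow (by positivity) hN0.le, Real.mul_rpow (by positivity) (by positivity),
      ← Real.rpow_mul hK0.le, one_div_mul_cancel hp0.ne', Real.rpow_one]
  have hN2 : (2 * N) ^ p = 2 ^ p * N ^ p := Real.mul_rpow (by norm_num) hN0.le
  rw [h1, hR, hL, hN2, hK]
  ring

/-- Multiplying the estimate of `exists_eLpNorm_fourier_le` with the one obtained from Fourier
inversion, the norms of `f` and `h` cancel. -/
theorem exists_le_mul_of_one_lt {p q : ℝ} (hq1 : 1 < q) (hq2 : q < 2) (hqp : q < p)
    (hpq : p < q / (q - 1)) (hn : finrank ℝ V * (1 / q - 1 / p) < 1) (hn0 : 0 < finrank ℝ V) :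
    ∃ c : ℝ, 0 < c ∧ ∀ f h : V → ℂ, IsFourierPair f h → ∀ A B : ℝ, 0 < A → 0 < B →
      MemLp f (ENNReal.ofReal p) volume → MemLp h (ENNReal.ofReal p) volume →
      ¬ f =ᵐ[volume] 0 →
      eLpNorm (fun x => (‖x‖ : ℂ) * f x) (ENNReal.ofReal p) volume ≤
        ENNReal.ofReal A * eLpNorm f (ENNReal.ofReal p) volume →
      eLpNorm (fun x => (‖x‖ : ℂ) * h x) (ENNReal.ofReal p) volume ≤
        ENNReal.ofReal B * eLpNorm h (ENNReal.ofReal p) volume →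
      c ≤ A * B := by
  obtain ⟨C, hC, hmain⟩ := exists_eLpNorm_fourier_le (V := V) hq1 hq2 hqp hpq hn
  have hp0 : 0 < p := by linarith
  have hpne : ENNReal.ofReal p ≠ 0 := by simpa using hp0
  set n := finrank ℝ V with hndef
  set a : ℝ := n * (1 / q - 1 / p) with ha
  set b : ℝ := n * (1 / p - (1 - 1 / q)) with hb
  have hab : 0 < a + b := by
    have h1 : a + b = n * (2 * (1 / q) - 1) := by rw [ha, hb]; ring
    have h2 : 1 / 2 < 1 / q := one_div_lt_one_div_of_lt (by linarith) hq2
    have h3 : (0 : ℝ) < n := by exact_mod_cast hn0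
    rw [h1]
    have : 0 < 2 * (1 / q) - 1 := by linarith
    positivity
  refine ⟨((C ^ 2)⁻¹) ^ (1 / (a + b)), by positivity,
    fun f h H A B hA hB hf hh hf0 hfA hhB => ?_⟩
  have hh0 : ¬ h =ᵐ[volume] 0 := fun h0 => hf0 (H.ae_eq_zero h0)
  have hF : 0 < (eLpNorm f (ENNReal.ofReal p) volume).toReal :=
    ENNReal.toReal_pos (fun h0 => hf0 ((eLpNorm_eq_zero_iff hf.1 hpne).1 h0)) hf.eLpNorm_ne_top
  have hG : 0 < (eLpNorm h (ENNReal.ofReal p) volume).toReal :=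
    ENNReal.toReal_pos (fun h0 => hh0 ((eLpNorm_eq_zero_iff hh.1 hpne).1 h0)) hh.eLpNorm_ne_top
  have hFeq := (ENNReal.ofReal_toReal hf.eLpNorm_ne_top).symm
  have hGeq := (ENNReal.ofReal_toReal hh.eLpNorm_ne_top).symm
  set F := (eLpNorm f (ENNReal.ofReal p) volume).toReal
  set G := (eLpNorm h (ENNReal.ofReal p) volume).toReal
  have h1 := hmain f h H A B F hA hB hF hf hh hFeq.le hfA hhB
  have hh' : MemLp (fun x => h (-x)) (ENNReal.ofReal p) volume :=
    hh.comp_measurePreserving (Measure.measurePreserving_neg volume)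
  have h2 := hmain (fun x => h (-x)) f H.symm B A G hB hA hG hh' hf
    (by rw [eLpNorm_comp_neg _ hh.1]; exact hGeq.le)
    (by rwa [eLpNorm_norm_mul_comp_neg _ hh.1, eLpNorm_comp_neg _ hh.1]) hfA
  rw [hGeq, ENNReal.ofReal_le_ofReal_iff (by positivity)] at h1
  rw [hFeq, ENNReal.ofReal_le_ofReal_iff (by positivity)] at h2
  have h3 : F * G ≤ C ^ 2 * (A * B) ^ (a + b) * (F * G) := by
    calc F * G ≤ (C * B ^ a * A ^ b * G) * (C * A ^ a * B ^ b * F) := by gcongr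
      _ = _ := by
        rw [Real.mul_rpow hA.le hB.le, Real.rpow_add hA, Real.rpow_add hB]
        ring
  have h4 : 1 ≤ C ^ 2 * (A * B) ^ (a + b) := by
    have hFG : 0 < F * G := by positivity
    exact le_of_mul_le_mul_right (by linarith) hFG
  have h5 : (C ^ 2)⁻¹ ≤ (A * B) ^ (a + b) := by
    rw [inv_le_iff_one_le_mul₀ (by positivity)]
    linarith
  calc _ ≤ ((A * B) ^ (a + b)) ^ (1 / (a + b)) := by gcongr
    _ = A * B := by
      rw [← Real.rpow_mul (by positivity), mul_one_div_cancel hab.ne', Real.rpow_one]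

theorem lintegral_enorm_le_of_enorm_le {α E : Type*} [MeasurableSpace α] [NormedAddCommGroup E]
    {μ : Measure α} {p : ℝ} (hp0 : 0 < p) (hp1 : p ≤ 1) {u : α → E} {K : ℝ≥0∞} (hK : K ≠ ⊤)
    (hu : ∀ᵐ x ∂μ, ‖u x‖ₑ ≤ K) :
    ∫⁻ x, ‖u x‖ₑ ∂μ ≤ K ^ (1 - p) * ∫⁻ x, ‖u x‖ₑ ^ p ∂μ := by
  rw [← lintegral_const_mul' _ _ (ENNReal.rpow_ne_top_of_nonneg (by linarith) hK)]
  refine lintegral_mono_ae ?_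
  filter_upwards [hu] with x hx
  calc ‖u x‖ₑ = ‖u x‖ₑ ^ (1 - p) * ‖u x‖ₑ ^ p := by
        rw [← ENNReal.rpow_add_of_nonneg _ _ (by linarith) hp0.le, sub_add_cancel, ENNReal.rpow_one]
    _ ≤ _ := by
        gcongr

/-- A function bounded by `K` whose `L^p` first moment is controlled by `B`, `p ≤ 1`, has `L¹` norm at
most of order `B ^ n * K`: it behaves as if it were supported in a ball of radius `B`. -/
theorem lintegral_enorm_le_of_moment {p B : ℝ} (hp0 : 0 < p) (hp1 : p ≤ 1) (hB : 0 < B)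
    {u : V → ℂ} {K : ℝ≥0∞} (hK : K ≠ ⊤) (hu : ∀ᵐ x, ‖u x‖ₑ ≤ K)
    (hup : MemLp u (ENNReal.ofReal p) volume)
    (hle : eLpNorm (fun x => (‖x‖ : ℂ) * u x) (ENNReal.ofReal p) volume ≤
      ENNReal.ofReal B * eLpNorm u (ENNReal.ofReal p) volume) :
    ∫⁻ x, ‖u x‖ₑ ≤
      ENNReal.ofReal (2 * ((2 ^ (1 / p) * B) ^ finrank ℝ V *
        (volume (Metric.ball (0 : V) 1)).toReal)) * K := by
  have h1 : ∫⁻ x in Metric.closedBall (0 : V) (2 ^ (1 / p) * B), ‖u x‖ₑ ^ p ≤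
      K ^ p * volume (Metric.closedBall (0 : V) (2 ^ (1 / p) * B)) := by
    rw [← setLIntegral_const]
    refine lintegral_mono_ae (ae_restrict_of_ae ?_)
    filter_upwards [hu] with x hx
    gcongr
  rw [volume_closedBall_eq _ (by positivity)] at h1
  set v := (2 ^ (1 / p) * B) ^ finrank ℝ V * (volume (Metric.ball (0 : V) 1)).toReal
  calc ∫⁻ x, ‖u x‖ₑ ≤ K ^ (1 - p) * ∫⁻ x, ‖u x‖ₑ ^ p :=
        lintegral_enorm_le_of_enorm_le hp0 hp1 hK hu
    _ ≤ K ^ (1 - p) * (2 * (K ^ p * ENNReal.ofReal v)) := by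
        gcongr
        exact (lintegral_le_two_mul_lintegral_closedBall hp0 hB hup hle).trans
          (mul_le_mul_right h1 2)
    _ = 2 * ENNReal.ofReal v * (K ^ (1 - p) * K ^ p) := by ring
    _ = _ := by
        rw [← ENNReal.rpow_add_of_nonneg _ _ (by linarith) hp0.le, sub_add_cancel,
          ENNReal.rpow_one, ENNReal.ofReal_mul (by norm_num : (0 : ℝ) ≤ 2), ENNReal.ofReal_ofNat]

/-- For `p ≤ 1` the trivial bounds `‖h‖_∞ ≤ ‖f‖_1` and `‖f‖_∞ ≤ ‖h‖_1` suffice: localization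
gives `‖f‖_1 ≤ C A ^ n ‖f‖_∞` and `‖h‖_1 ≤ C B ^ n ‖h‖_∞`, and the four bounds form a cycle. -/
theorem exists_le_mul_of_le_one {p : ℝ} (hp0 : 0 < p) (hp1 : p ≤ 1) (hn0 : 0 < finrank ℝ V) :
    ∃ c : ℝ, 0 < c ∧ ∀ f h : V → ℂ, IsFourierPair f h → ∀ A B : ℝ, 0 < A → 0 < B →
      MemLp f (ENNReal.ofReal p) volume → Integrable f → MemLp h (ENNReal.ofReal p) volume →
      ¬ f =ᵐ[volume] 0 →
      eLpNorm (fun x => (‖x‖ : ℂ) * f x) (ENNReal.ofReal p) volume ≤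
        ENNReal.ofReal A * eLpNorm f (ENNReal.ofReal p) volume →
      eLpNorm (fun x => (‖x‖ : ℂ) * h x) (ENNReal.ofReal p) volume ≤
        ENNReal.ofReal B * eLpNorm h (ENNReal.ofReal p) volume →
      c ≤ A * B := by
  set n := finrank ℝ V with hndef
  set w := (volume (Metric.ball (0 : V) 1)).toReal with hw
  have hw0 : 0 < w := toReal_volume_ball_pos
  set D : ℝ := 2 * ((2 ^ (1 / p)) ^ n * w) with hD
  have hD0 : 0 < D := by positivity
  refine ⟨((D ^ 2)⁻¹) ^ (1 / (n : ℝ)), by positivity,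
    fun f h H A B hA hB hf hfi hh hf0 hfA hhB => ?_⟩
  have hf1 : eLpNorm f 1 volume ≠ ⊤ := (memLp_one_iff_integrable.2 hfi).eLpNorm_ne_top
  have hh_le := lintegral_enorm_le_of_moment hp0 hp1 hB hf1 (H.enorm_le_of_integrable hfi) hh hhB
  rw [← eLpNorm_one_eq_lintegral_enorm] at hh_le
  have hh1 : MemLp h 1 volume :=
    ⟨hh.1, hh_le.trans_lt (ENNReal.mul_lt_top ENNReal.ofReal_lt_top hf1.lt_top)⟩
  have hf_bdd := H.symm.enorm_le_of_integrable (memLp_one_iff_integrable.1 hh1).comp_neg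
  rw [eLpNorm_comp_neg _ hh.1] at hf_bdd
  have hf_le := lintegral_enorm_le_of_moment hp0 hp1 hA hh1.eLpNorm_ne_top hf_bdd hf hfA
  rw [← eLpNorm_one_eq_lintegral_enorm] at hf_le
  have h1 := hf_le.trans (mul_le_mul_right hh_le _)
  have hF : 0 < (eLpNorm f 1 volume).toReal :=
    ENNReal.toReal_pos (fun h0 => hf0 ((eLpNorm_eq_zero_iff hf.1 one_ne_zero).1 h0)) hf1
  rw [← ENNReal.ofReal_toReal hf1, ← ENNReal.ofReal_mul (by positivity),
    ← ENNReal.ofReal_mul (by positivity), ENNReal.ofReal_le_ofReal_iff (by positivity)] at h1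
  have h2 : 1 ≤ D ^ 2 * (A * B) ^ n := by
    refine le_of_mul_le_mul_right (h1.trans' (one_mul _).le |>.trans (le_of_eq ?_)) hF
    rw [hD]
    ring
  have h3 : (D ^ 2)⁻¹ ≤ (A * B) ^ n := by
    rw [inv_le_iff_one_le_mul₀ (by positivity)]
    linarith
  calc _ ≤ ((A * B) ^ n) ^ (1 / (n : ℝ)) := by gcongr
    _ = A * B := by
      rw [one_div, Real.pow_rpow_inv_natCast (by positivity) hn0.ne']

/-- An auxiliary exponent `q` strictly between `1` and `min 2 p`, with conjugate exponent above `p`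
and with `1 / q` within `1 / n` of `1 / p`. The upper bound on `p` is exactly what makes room for
it. -/
theorem exists_auxiliary_exponent {p n : ℝ} (hp : 1 < p) (hn : 1 ≤ n) (hpn : p * (n - 1) < 2 * n) :
    ∃ q : ℝ, 1 < q ∧ q < 2 ∧ q < p ∧ p < q / (q - 1) ∧ n * (1 / q - 1 / p) < 1 := by
  have hp0 : 0 < p := by linarith
  have hn0 : 0 < n := by linarith
  have hp1 : 1 / p < 1 := by rw [div_lt_one hp0]; exact hp
  have hpp : 0 < 1 / p := by positivity
  have hnn : 0 < 1 / n := by positivity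
  have hroom : 1 - 1 / p < 1 / p + 1 / n := by
    have : 1 / p + 1 / n - (1 - 1 / p) = (2 * n - p * (n - 1)) / (p * n) := by field_simp; ring
    have h2 : 0 < (2 * n - p * (n - 1)) / (p * n) := div_pos (by linarith) (by positivity)
    linarith
  obtain ⟨y, hy1, hy2⟩ : ∃ y, max (1 / 2) (max (1 / p) (1 - 1 / p)) < y ∧
      y < min 1 (1 / p + 1 / n) := by
    refine exists_between (max_lt ?_ (max_lt ?_ ?_)) <;> refine lt_min ?_ ?_ <;> linarith
  simp only [max_lt_iff, lt_min_iff] at hy1 hy2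
  obtain ⟨hy_half, hy_p, hy_p'⟩ := hy1
  have hy0 : 0 < y := by linarith
  refine ⟨1 / y, ?_, ?_, ?_, ?_, ?_⟩
  · rw [lt_div_iff₀ hy0]; linarith
  · rw [div_lt_iff₀ hy0]; linarith
  · rw [div_lt_iff₀ hy0]
    rwa [div_lt_iff₀ hp0, mul_comm] at hy_p
  · have h1 : 1 / y / (1 / y - 1) = 1 / (1 - y) := by
      have : 1 - y ≠ 0 := by linarith
      have : 1 / y - 1 ≠ 0 := by
        rw [div_sub_one hy0.ne']
        positivity
      field_simp
    rw [h1, lt_div_iff₀ (by linarith)]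
    have : p * (1 - y) < p * (1 / p) := by gcongr; linarith
    rwa [mul_one_div_cancel hp0.ne'] at this
  · rw [one_div_one_div]
    calc n * (y - 1 / p) < n * (1 / n) := by gcongr; linarith
      _ = 1 := mul_one_div_cancel hn0.ne'

/-- The uncertainty inequality for Mathlib's normalization of the Fourier transform. The ratios of
norms enter through upper bounds `A` and `B`, so no division is involved. -/
theorem exists_le_mul {p : ℝ} (hp0 : 0 < p) (hn0 : 0 < finrank ℝ V)
    (hpn : p * (finrank ℝ V - 1) < 2 * finrank ℝ V) :
    ∃ c : ℝ, 0 < c ∧ ∀ f h : V → ℂ, IsFourierPair f h → ∀ A B : ℝ, 0 < A → 0 < B →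
      MemLp f (ENNReal.ofReal p) volume → (p < 1 → Integrable f) →
      MemLp h (ENNReal.ofReal p) volume → ¬ f =ᵐ[volume] 0 →
      eLpNorm (fun x => (‖x‖ : ℂ) * f x) (ENNReal.ofReal p) volume ≤
        ENNReal.ofReal A * eLpNorm f (ENNReal.ofReal p) volume →
      eLpNorm (fun x => (‖x‖ : ℂ) * h x) (ENNReal.ofReal p) volume ≤
        ENNReal.ofReal B * eLpNorm h (ENNReal.ofReal p) volume →
      c ≤ A * B := by
  rcases le_or_gt p 1 with hp | hp
  · obtain ⟨c, hc, hmain⟩ := exists_le_mul_of_le_one (V := V) hp0 hp hn0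
    refine ⟨c, hc, fun f h H A B hA hB hf hfi => hmain f h H A B hA hB hf ?_⟩
    rcases hp.lt_or_eq with hp' | rfl
    · exact hfi hp'
    · rwa [ENNReal.ofReal_one, memLp_one_iff_integrable] at hf
  · obtain ⟨q, hq1, hq2, hqp, hpq, hn⟩ :=
      exists_auxiliary_exponent hp (by exact_mod_cast hn0) hpn
    obtain ⟨c, hc, hmain⟩ := exists_le_mul_of_one_lt (V := V) hq1 hq2 hqp hpq hn hn0
    exact ⟨c, hc, fun f h H A B hA hB hf _ => hmain f h H A B hA hB hf⟩

end Uncertainty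

/-! ### Change of normalization -/

section Normalization

open Real FourierTransform

variable {n : ℕ}

theorem fourierIntegralExp_comp_smul (ψ : EuclideanSpace ℝ (Fin n) → ℂ)
    (x : EuclideanSpace ℝ (Fin n)) :
    fourierIntegralExp (fun ξ => ψ ((2 * π)⁻¹ • ξ)) x = ((2 * π) ^ n : ℝ) • 𝓕 ψ x := by
  have h := Measure.integral_comp_smul volume
    (fun ξ => Complex.exp (-(Complex.I * ((inner ℝ ξ x : ℝ) : ℂ))) * ψ ((2 * π)⁻¹ • ξ)) (2 * π)
  rw [finrank_euclideanSpace_fin, abs_of_pos (by positivity), eq_inv_smul_iff₀ (by positivity)] at h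
  rw [fourierIntegralExp, ← h, Real.fourier_eq']
  congr 1
  refine integral_congr_ae (ae_of_all _ fun η => ?_)
  simp only [smul_smul, smul_eq_mul]
  rw [inv_mul_cancel₀ (by positivity), one_smul, inner_smul_left]
  congr 2
  simp
  ring

/-- Dilating the transform by `2π` translates the normalization `∫ exp (-i x·ξ) f x dx` into that of
Mathlib. -/
theorem IsFourierTransform.isFourierPair {f g : EuclideanSpace ℝ (Fin n) → ℂ}
    (H : IsFourierTransform f g) : IsFourierPair f (fun ξ => g ((2 * π) • ξ)) := by
  have hr : (2 * π)⁻¹ ≠ 0 := by positivity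
  let e : EuclideanSpace ℝ (Fin n) ≃L[ℝ] EuclideanSpace ℝ (Fin n) :=
    ContinuousLinearEquiv.smulLeft (Units.mk0 _ hr)
  let D : 𝓢(EuclideanSpace ℝ (Fin n), ℂ) → 𝓢(EuclideanSpace ℝ (Fin n), ℂ) :=
    SchwartzMap.compCLMOfContinuousLinearEquiv ℂ e
  have hD : ∀ φ ξ, D φ ξ = φ ((2 * π)⁻¹ • ξ) := fun φ ξ => rfl
  have hDr : ∀ φ ξ, D φ ((2 * π) • ξ) = φ ξ := fun φ ξ => by
    rw [hD, smul_smul, inv_mul_cancel₀ (by positivity), one_smul]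
  refine ⟨H.pairs_left, fun φ => ?_, fun φ => ?_⟩
  · have := (H.pairs_right (D φ)).comp_smul (R := 2 * π) (by positivity)
    simpa only [hDr] using this
  · have h1 := Measure.integral_comp_smul volume (fun ξ => g ξ * D φ ξ) (2 * π)
    simp only [hDr] at h1
    rw [h1, H.integral_eq, finrank_euclideanSpace_fin, abs_of_pos (by positivity),
      inv_smul_eq_iff₀ (by positivity), ← integral_smul]
    refine integral_congr_ae (ae_of_all _ fun x => ?_)
    simp only [hD, fourierIntegralExp_comp_smul, SchwartzMap.fourier_coe, mul_smul_comm]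

end Normalization

theorem eLpNorm_norm_mul_ne_zero {V : Type*} [NormedAddCommGroup V] [InnerProductSpace ℝ V]
    [FiniteDimensional ℝ V] [MeasurableSpace V] [BorelSpace V] [Nontrivial V] {p : ℝ≥0∞}
    (hp : p ≠ 0) {u : V → ℂ} (hu : AEStronglyMeasurable u volume) (hu0 : ¬ u =ᵐ[volume] 0) :
    eLpNorm (fun x => (‖x‖ : ℂ) * u x) p volume ≠ 0 := by
  have hxu : AEStronglyMeasurable (fun x : V => (‖x‖ : ℂ) * u x) volume :=
    (by fun_prop : Continuous fun x : V => (‖x‖ : ℂ)).aestronglyMeasurable.mul hu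
  rw [Ne, eLpNorm_eq_zero_iff hxu hp]
  refine fun h0 => hu0 ?_
  filter_upwards [h0, Measure.ae_ne volume (0 : V)] with x hx hx0
  simpa [hx0] using hx

theorem mainTheorem5 (n : ℕ) (hn : 1 ≤ n) (p : ℝ≥0∞) (hp0 : 0 < p)
    (hp : p < 2 * (n : ℝ≥0∞) / ((n : ℝ≥0∞) - 1)) :
    ∃ c : ℝ≥0, 0 < c ∧
      ∀ f g : EuclideanSpace ℝ (Fin n) → ℂ,
        MemLp f p volume → (p < 1 → Integrable f volume) →
        MemLp g p volume → IsFourierTransform f g →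
        ¬ (f =ᵐ[volume] 0) →
        (c : ℝ≥0∞) ≤
          (eLpNorm (fun x => (‖x‖ : ℂ) * f x) p volume / eLpNorm f p volume) *
          (eLpNorm (fun ξ => (‖ξ‖ : ℂ) * g ξ) p volume / eLpNorm g p volume) := by
  have hpt : p ≠ ⊤ := (hp.trans_le le_top).ne
  obtain ⟨P, hP0, rfl⟩ : ∃ P : ℝ, 0 < P ∧ p = ENNReal.ofReal P :=
    ⟨p.toReal, ENNReal.toReal_pos hp0.ne' hpt, (ENNReal.ofReal_toReal hpt).symm⟩
  have : Nonempty (Fin n) := ⟨⟨0, hn⟩⟩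
  have hn1 : (0 : ℝ) ≤ n - 1 := by
    have : (1 : ℝ) ≤ n := by exact_mod_cast hn
    linarith
  have hPn : P * (n - 1) < 2 * n := by
    rcases hn1.eq_or_lt with h0 | h0
    -- For `n = 1` the bound on `p` in `ℝ≥0∞` is `2 / 0 = ⊤` and imposes nothing on `P`.
    · rw [← h0, mul_zero]
      positivity
    · rw [← ENNReal.ofReal_natCast n, ← ENNReal.ofReal_one, ← ENNReal.ofReal_sub _ zero_le_one,
        ← ENNReal.ofReal_ofNat 2, ← ENNReal.ofReal_mul (by norm_num), ← ENNReal.ofReal_div_of_pos h0,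
        ENNReal.ofReal_lt_ofReal_iff (by positivity), lt_div_iff₀ h0] at hp
      exact hp
  obtain ⟨c, hc, hmain⟩ := exists_le_mul (V := EuclideanSpace ℝ (Fin n)) hP0
    (by rw [finrank_euclideanSpace_fin]; exact hn) (by rw [finrank_euclideanSpace_fin]; exact hPn)
  refine ⟨c.toNNReal, by simpa using hc, fun f g hf hfi hg H hf0 => ?_⟩
  have hpne : ENNReal.ofReal P ≠ 0 := hp0.ne'
  have hpair := H.isFourierPair
  have hh := memLp_comp_const_smul (r := 2 * Real.pi) (by positivity) hg
  have hnorm := eLpNorm_comp_const_smul (r := 2 * Real.pi) hP0 (by positivity) g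
  have hg0 : ¬ g =ᵐ[volume] 0 := by
    refine fun h0 => hf0 (hpair.ae_eq_zero ((eLpNorm_eq_zero_iff hh.1 hpne).1 ?_))
    rw [hnorm, (eLpNorm_eq_zero_iff hg.1 hpne).2 h0, mul_zero]
  have hf_ne : eLpNorm f (ENNReal.ofReal P) volume ≠ 0 :=
    fun h0 => hf0 ((eLpNorm_eq_zero_iff hf.1 hpne).1 h0)
  have hg_ne : eLpNorm g (ENNReal.ofReal P) volume ≠ 0 :=
    fun h0 => hg0 ((eLpNorm_eq_zero_iff hg.1 hpne).1 h0)
  set X := eLpNorm (fun x => (‖x‖ : ℂ) * f x) (ENNReal.ofReal P) volume /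
    eLpNorm f (ENNReal.ofReal P) volume
  set Y := eLpNorm (fun ξ => (‖ξ‖ : ℂ) * g ξ) (ENNReal.ofReal P) volume /
    eLpNorm g (ENNReal.ofReal P) volume
  have hX0 : X ≠ 0 :=
    ENNReal.div_ne_zero.2 ⟨eLpNorm_norm_mul_ne_zero hpne hf.1 hf0, hf.eLpNorm_ne_top⟩
  have hY0 : Y ≠ 0 :=
    ENNReal.div_ne_zero.2 ⟨eLpNorm_norm_mul_ne_zero hpne hg.1 hg0, hg.eLpNorm_ne_top⟩
  rcases eq_or_ne X ⊤ with hXt | hXt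
  · rw [hXt, ENNReal.top_mul hY0]
    exact le_top
  rcases eq_or_ne Y ⊤ with hYt | hYt
  · rw [hYt, ENNReal.mul_top hX0]
    exact le_top
  have hfX : eLpNorm (fun x => (‖x‖ : ℂ) * f x) (ENNReal.ofReal P) volume =
      X * eLpNorm f (ENNReal.ofReal P) volume :=
    (ENNReal.div_mul_cancel hf_ne hf.eLpNorm_ne_top).symm
  have hgY : eLpNorm (fun x => (‖x‖ : ℂ) * g x) (ENNReal.ofReal P) volume =
      Y * eLpNorm g (ENNReal.ofReal P) volume :=
    (ENNReal.div_mul_cancel hg_ne hg.eLpNorm_ne_top).symm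
  -- The dilation by `2π` multiplies the ratio for `g` by `(2π)⁻¹`, hence does not increase it.
  have hhY : eLpNorm (fun x => (‖x‖ : ℂ) * g ((2 * Real.pi) • x)) (ENNReal.ofReal P) volume ≤
      Y * eLpNorm (fun x => g ((2 * Real.pi) • x)) (ENNReal.ofReal P) volume := by
    have h1 := eLpNorm_comp_const_smul (r := 2 * Real.pi) hP0 (by positivity)
      (fun x => (‖x‖ : ℂ) * g x)
    rw [hnorm, mul_left_comm, ← hgY, ← h1]
    refine eLpNorm_mono fun x => ?_
    rw [norm_mul, norm_mul, Complex.norm_real, Complex.norm_real, norm_norm, norm_norm, norm_smul,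
      Real.norm_of_nonneg (by positivity)]
    gcongr
    exact le_mul_of_one_le_left (norm_nonneg _) (by linarith [Real.pi_gt_three])
  have hkey := hmain f _ hpair X.toReal Y.toReal (ENNReal.toReal_pos hX0 hXt)
    (ENNReal.toReal_pos hY0 hYt) hf (fun h1 => hfi (by simpa using h1)) hh hf0
    (by rw [ENNReal.ofReal_toReal hXt]; exact hfX.le)
    (by rw [ENNReal.ofReal_toReal hYt]; exact hhY)
  rw [← ENNReal.toReal_mul] at hkey
  exact (ENNReal.ofReal_le_iff_le_toReal (ENNReal.mul_ne_top hXt hYt)).2 hkey
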